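/- Let $\alpha$ be a real number with $0\leq\alpha<\frac{2}{3}$, and let $G$ be a connected finite simple graph of order $n$ with $n\geq 25$. For a finite simple graph $F$, let $A(F)$ be its adjacency matrix, $D(F)$ the diagonal matrix of its vertex degrees, and let $\lambda_\alpha(F)$ denote the largest eigenvalue of $A_\alpha(F)=\alpha D(F)+(1-\alpha)A(F)$. Let $K_1\vee(K_{n-2}\cup K_1)$ be the graph obtained from the disjoint union of the complete graphs $K_{n-2}$ and $K_1$ by adding one new vertex adjacent to all of their vertices. If $$\lambda_\alpha(G)\geq\lambda_\alpha\bigl(K_1\vee(K_{n-2}\cup K_1)\bigr),$$ then $G$ has a $\{P_3,P_4,P_5\}$-factor, that is, a spanning subgraph each of whose connected components is isomorphic to one of the paths $P_3,P_4,P_5$ on $3$, $4$, $5$ vertices, unless $G$ is isomorphic to $K_1\vee(K_{n-2}\cup K_1)$. -/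

import Mathlib

/-- The join `G ∨ H`: the disjoint union of `G` and `H` together with all edges between
a vertex of `G` and a vertex of `H`. -/
def graphJoin {V W : Type*} (G : SimpleGraph V) (H : SimpleGraph W) : SimpleGraph (V ⊕ W) :=
  (G ⊕g H) ⊔ completeBipartiteGraph V W

/-- The graph `K_1 ∨ (K_{n-2} ∪ K_1)`, of order `n` when `2 ≤ n`. -/
def extremalGraph (n : ℕ) : SimpleGraph (Fin 1 ⊕ (Fin (n - 2) ⊕ Fin 1)) :=
  graphJoin (SimpleGraph.completeGraph (Fin 1))
    (SimpleGraph.completeGraph (Fin (n - 2)) ⊕g SimpleGraph.completeGraph (Fin 1))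

/-- The matrix `A_α(G) = α D(G) + (1 - α) A(G)`. -/
noncomputable def aAlphaMatrix {V : Type*} [Fintype V] [DecidableEq V] (α : ℝ)
    (G : SimpleGraph V) [DecidableRel G.Adj] : Matrix V V ℝ :=
  α • G.degMatrix ℝ + (1 - α) • G.adjMatrix ℝ

open Classical in
/-- The largest eigenvalue `λ_α(G)` of `A_α(G)`; it is attained by `isGreatest_lambdaAlpha`. -/
noncomputable def lambdaAlpha {V : Type*} [Fintype V] (α : ℝ) (G : SimpleGraph V) : ℝ :=
  sSup (spectrum ℝ (aAlphaMatrix α G))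

theorem aAlphaMatrix_isHermitian {V : Type*} [Fintype V] [DecidableEq V] (α : ℝ)
    (G : SimpleGraph V) [DecidableRel G.Adj] : (aAlphaMatrix α G).IsHermitian := by
  unfold aAlphaMatrix
  rw [Matrix.IsHermitian, Matrix.conjTranspose_eq_transpose_of_trivial, Matrix.transpose_add,
    Matrix.transpose_smul, Matrix.transpose_smul, SimpleGraph.transpose_adjMatrix,
    SimpleGraph.degMatrix, Matrix.diagonal_transpose]

open Classical in
/-- For a nonempty graph, `λ_α(G)` really is the largest eigenvalue of `A_α(G)`. -/
theorem isGreatest_lambdaAlpha {V : Type*} [Fintype V] [Nonempty V] (α : ℝ)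
    (G : SimpleGraph V) :
    IsGreatest {μ : ℝ | Module.End.HasEigenvalue (Matrix.toLin' (aAlphaMatrix α G)) μ}
      (lambdaAlpha α G) := by
  have hs : {μ : ℝ | Module.End.HasEigenvalue (Matrix.toLin' (aAlphaMatrix α G)) μ}
      = spectrum ℝ (aAlphaMatrix α G) := by
    ext μ
    rw [Set.mem_ofPred_eq, Module.End.hasEigenvalue_iff_mem_spectrum, Matrix.spectrum_toLin']
  have hfin : (spectrum ℝ (aAlphaMatrix α G)).Finite := Matrix.finite_real_spectrum
  have hne : (spectrum ℝ (aAlphaMatrix α G)).Nonempty := by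
    rw [(aAlphaMatrix_isHermitian α G).spectrum_real_eq_range_eigenvalues]
    exact Set.range_nonempty _
  rw [hs]
  exact ⟨hne.csSup_mem hfin, fun μ hμ => le_csSup hfin.bddAbove hμ⟩

/-- `G` has a `{P_k : k ∈ K}`-factor: a spanning subgraph `H` of `G` each of whose connected
components is isomorphic to the path `P_k` on `k` vertices for some `k ∈ K`. -/
def HasPathFactor {V : Type*} (K : Set ℕ) (G : SimpleGraph V) : Prop :=
  ∃ H : SimpleGraph V, H ≤ G ∧
    ∀ C : H.ConnectedComponent, ∃ k ∈ K, Nonempty (C.toSimpleGraph ≃g SimpleGraph.pathGraph k)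

/-! The graph `G` even has a Hamiltonian path, and a path on at least three vertices can be cut into
pieces of 3, 4 or 5 vertices. The exceptional graph has such a path too (pendant vertex, centre,
clique), so the first alternative always holds.

The exceptional graph contains a clique on `n - 1` vertices, hence `λ_α(G) ≥ n - 2`. If the degree
sum were at most `n² - 5n + 10`, row-sum estimates would contradict this
(`lt_sum_degree_of_le_lambdaAlpha`). A larger degree sum with no isolated vertex forces a
Hamiltonian path by an Ore closure argument (`exists_isHamiltonianList_of_lt_sum_degree`). The
threshold is the degree sum of `K_1 ∨ (K_{n-3} ∪ 2K_1)`, which has no Hamiltonian path. -/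

/-! ### Cutting a Hamiltonian path into short paths. -/

theorem hasPathFactor_of_equiv_fin {V : Type*} {n : ℕ} (hn : 3 ≤ n) (G : SimpleGraph V)
    (e : V ≃ Fin n) (h : ∀ x y, (e x : ℕ) + 1 = e y → G.Adj x y) :
    HasPathFactor {3, 4, 5} G := by
  -- Blocks of three consecutive positions; the `min` makes the last block absorb the remainder `n %
  -- 3`, so it has 3, 4 or 5 positions.
  let b : ℕ → ℕ := fun i => min (i / 3) (n / 3 - 1)
  let H : SimpleGraph V :=
    { Adj := fun x y => b (e x) = b (e y) ∧ ((e x : ℕ) + 1 = e y ∨ (e y : ℕ) + 1 = e x)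
      symm := ⟨fun x y hxy => ⟨hxy.1.symm, hxy.2.symm⟩⟩
      loopless := ⟨fun x hx => by omega⟩ }
  have hreach_b : ∀ x y, H.Reachable x y → b (e x) = b (e y) := by
    rintro x y ⟨w⟩
    induction w with
    | nil => rfl
    | cons hadj _ ih => exact hadj.1.trans ih
  have hb_reach : ∀ d : ℕ, ∀ x y, (e x : ℕ) + d = e y → b (e x) = b (e y) →
      H.Reachable x y := by
    intro d
    induction d with
    | zero =>
      intro x y hxy _
      have : x = y := e.injective (Fin.ext (by omega))
      exact this ▸ SimpleGraph.Reachable.refl _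
    | succ d ih =>
      intro x y hxy hb
      have hy := (e y).2
      let z : V := e.symm ⟨e x + 1, by omega⟩
      have hz : (e z : ℕ) = e x + 1 := by simp [z]
      have hbz : b (e x) = b (e z) := by simp only [b] at hb ⊢; omega
      have hadj : H.Adj x z := ⟨hbz, Or.inl hz.symm⟩
      exact hadj.reachable.trans (ih z y (by omega) (hbz ▸ hb))
  refine ⟨H, ?_, ?_⟩
  · rintro x y ⟨_, hxy | hxy⟩
    · exact h x y hxy
    · exact (h y x hxy).symm
  · intro C
    induction C using SimpleGraph.ConnectedComponent.ind with | _ v =>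
    have hv := (e v).2
    obtain ⟨s, k, hk, hsn, hs⟩ : ∃ s k : ℕ, k ∈ ({3, 4, 5} : Set ℕ) ∧ s + k ≤ n ∧
        ∀ i, i < n → (b i = b (e v) ↔ s ≤ i ∧ i < s + k) := by
      by_cases hlast : (e v : ℕ) / 3 < n / 3 - 1
      · refine ⟨3 * ((e v : ℕ) / 3), 3, by simp, by omega, fun i hi => ?_⟩
        simp only [b]; omega
      · refine ⟨3 * (n / 3 - 1), n - 3 * (n / 3 - 1), ?_, by omega, fun i hi => ?_⟩
        · simp only [Set.mem_insert_iff, Set.mem_singleton_iff]; omega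
        · simp only [b]; omega
    have hmem : ∀ x, x ∈ H.connectedComponentMk v ↔ s ≤ (e x : ℕ) ∧ (e x : ℕ) < s + k := by
      intro x
      rw [← hs _ (e x).2]
      change H.connectedComponentMk x = H.connectedComponentMk v ↔ _
      rw [SimpleGraph.ConnectedComponent.eq]
      refine ⟨hreach_b x v, fun hb => ?_⟩
      rcases le_total (e x : ℕ) (e v) with hle | hle
      · exact hb_reach _ x v (Nat.add_sub_cancel' hle) hb
      · exact (hb_reach _ v x (Nat.add_sub_cancel' hle) hb.symm).symm
    refine ⟨k, hk, ⟨⟨⟨fun x => ⟨e x.1 - s, ?_⟩, fun i => ⟨e.symm ⟨s + i, ?_⟩, ?_⟩, ?_, ?_⟩, ?_⟩⟩⟩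
    · have := (hmem x.1).1 x.2; omega
    · have := i.2; omega
    · exact (hmem _).2 (by simp)
    · intro x
      have := (hmem x.1).1 x.2
      apply Subtype.ext
      apply e.injective
      apply Fin.ext
      simp; omega
    · intro i
      apply Fin.ext
      simp
    · rintro ⟨x, hx⟩ ⟨y, hy⟩
      have h1 := (hmem x).1 hx
      have h2 := (hmem y).1 hy
      have h3 := (hs _ (e x).2).2 h1
      have h4 := (hs _ (e y).2).2 h2
      rw [SimpleGraph.pathGraph_adj]
      change _ ↔ H.Adj x y
      simp only [Equiv.coe_fn_mk]
      constructor
      · intro h5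
        exact ⟨h3.trans h4.symm, by omega⟩
      · rintro ⟨_, h5⟩
        omega

/-- A list that enumerates a Hamiltonian path of `G`. -/
def IsHamiltonianList {V : Type*} (G : SimpleGraph V) (l : List V) : Prop :=
  l.Nodup ∧ (∀ v, v ∈ l) ∧ l.IsChain G.Adj

theorem IsHamiltonianList.hasPathFactor {V : Type*} {G : SimpleGraph V} {l : List V}
    (hl : IsHamiltonianList G l) (h3 : 3 ≤ l.length) : HasPathFactor {3, 4, 5} G := by
  classical
  let e := (hl.1.getEquivOfForallMemList l hl.2.1).symm
  refine hasPathFactor_of_equiv_fin h3 G e fun x y hxy => ?_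
  obtain ⟨i, rfl⟩ := e.symm.surjective x
  obtain ⟨j, rfl⟩ := e.symm.surjective y
  simp only [Equiv.apply_symm_apply] at hxy
  have := List.isChain_iff_getElem.1 hl.2.2 i (by omega)
  simp only [hxy] at this
  exact this

/-! ### Hamiltonian paths from degree sums. -/

open Finset

theorem IsHamiltonianList.of_perm {V : Type*} {G : SimpleGraph V} {l l' : List V}
    (hnd : l.Nodup) (hmem : ∀ v, v ∈ l) (hp : l'.Perm l) (hc : l'.IsChain G.Adj) :
    IsHamiltonianList G l' :=
  ⟨hp.nodup_iff.2 hnd, fun v => hp.mem_iff.2 (hmem v), hc⟩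

/-- Each consecutive pair is charged for `P` at its left entry and for `Q` at its right entry, so it
pays at most one; the last entry fails `P`, and the head is not counted for `Q`. -/
theorem List.countP_add_countP_tail_le {V : Type*} (P Q : V → Prop) [DecidablePred P]
    [DecidablePred Q] (a : V) (l : List V) (hc : (a :: l).IsChain fun x y => ¬(P x ∧ Q y))
    (hlast : ∀ x ∈ (a :: l).getLast?, ¬ P x) :
    (a :: l).countP (fun x => P x) + l.countP (fun x => Q x) ≤ l.length := by
  induction l generalizing a with
  | nil => simpa using hlast
  | cons b l ih =>
    rw [List.isChain_cons_cons] at hc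
    have := ih b hc.2 (by simpa using hlast)
    rw [List.countP_cons, List.countP_cons (a := b) (p := fun x => decide (Q x)),
      List.length_cons]
    have h := hc.1
    have : (if decide (P a) = true then 1 else 0) + (if decide (Q b) = true then 1 else 0) ≤ 1 := by
      by_cases hP : P a <;> by_cases hQ : Q b <;> simp_all
    omega

open Classical in
theorem SimpleGraph.degree_eq_countP {V : Type*} [Fintype V] (G : SimpleGraph V) {l : List V}
    (hnd : l.Nodup) (hmem : ∀ v, v ∈ l) (u : V) :
    G.degree u = l.countP (fun x => G.Adj u x) := by
  have : G.neighborFinset u = (l.filter fun x => G.Adj u x).toFinset := by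
    ext x; simp [hmem x]
  rw [← G.card_neighborFinset_eq_degree, this, List.toFinset_card_of_nodup (hnd.filter _),
    List.countP_eq_length_filter]

theorem SimpleGraph.isChain_adj_reverse {V : Type*} {G : SimpleGraph V} {l : List V} :
    l.reverse.IsChain G.Adj ↔ l.IsChain G.Adj := by
  rw [List.isChain_reverse]
  exact List.IsChain.iff fun a b => G.adj_comm b a

open Classical in
/-- If the vertices of `G` split into two paths, one ending in `u` and the other starting in `v`,
and `G` has no Hamiltonian path, then `d(u) + d(v) ≤ n - 2`. -/
theorem degree_add_degree_of_two_paths {V : Type*} [Fintype V] {G : SimpleGraph V}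
    (hG : ¬ ∃ l, IsHamiltonianList G l) {A B : List V} {u v : V}
    (hnd : (A ++ u :: v :: B).Nodup) (hmem : ∀ x, x ∈ A ++ u :: v :: B)
    (hA : (A ++ [u]).IsChain G.Adj) (hB : (v :: B).IsChain G.Adj) :
    G.degree u + G.degree v + 2 ≤ Fintype.card V := by
  have hcard : Fintype.card V = A.length + B.length + 2 := by
    have huniv : (A ++ u :: v :: B).toFinset = Finset.univ := by
      exact Finset.eq_univ_of_forall fun x => List.mem_toFinset.2 (hmem x)
    rw [← Finset.card_univ, ← huniv, List.toFinset_card_of_nodup hnd]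
    simp only [List.length_append, List.length_cons]
    omega
  have hno : ∀ l : List V, l.Perm (A ++ u :: v :: B) → ¬ l.IsChain G.Adj :=
    fun l hp hc => hG ⟨l, .of_perm hnd hmem hp hc⟩
  -- Otherwise `A, u` followed by the reversed second path is Hamiltonian.
  have hBl : ∀ x ∈ (v :: B).getLast?, ¬ G.Adj u x := by
    intro x hx hux
    refine hno ((A ++ [u]) ++ (v :: B).reverse) ?_ ?_
    · rw [List.append_assoc]
      exact List.Perm.append_left _ (List.Perm.cons _ (List.reverse_perm _))
    · refine hA.append (SimpleGraph.isChain_adj_reverse.2 hB) ?_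
      rw [List.head?_reverse]
      intro y hy z hz
      simp at hy
      rw [← hy, Option.mem_unique hz hx]
      exact hux
  have hAh : ∀ x ∈ (A ++ [u]).head?, ¬ G.Adj v x := by
    intro x hx hvx
    refine hno ((A ++ [u]).reverse ++ (v :: B)) ?_ ?_
    · have : A ++ u :: v :: B = (A ++ [u]) ++ (v :: B) := by simp
      rw [this]
      exact List.Perm.append_right _ (List.reverse_perm _)
    · refine (SimpleGraph.isChain_adj_reverse.2 hA).append hB ?_
      rw [List.getLast?_reverse]
      intro y hy z hz
      simp only [List.head?_cons, Option.mem_def, Option.some.injEq] at hz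
      rw [← hz, Option.mem_unique hy hx]
      exact hvx.symm
  -- Crossing: if `x, y` are consecutive, `u ~ x` and `v ~ y`, then `A, u, x, …, v, y, …` is
  -- Hamiltonian.
  have hBc : (v :: B).IsChain fun x y => ¬(G.Adj u x ∧ G.Adj v y) := by
    rw [List.isChain_iff_forall_rel_of_append_cons_cons]
    rintro x y l₁ l₂ hl ⟨hx, hy⟩
    have hl' : v :: B = (l₁ ++ [x]) ++ (y :: l₂) := by simp [hl]
    rw [hl'] at hB
    refine hno ((A ++ [u]) ++ ((l₁ ++ [x]).reverse ++ (y :: l₂))) ?_ ?_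
    · have : A ++ u :: v :: B = (A ++ [u]) ++ ((l₁ ++ [x]) ++ (y :: l₂)) := by
        rw [← hl']; simp
      rw [this]
      exact List.Perm.append_left _ (List.Perm.append_right _ (List.reverse_perm _))
    · refine hA.append ((SimpleGraph.isChain_adj_reverse.2 hB.left_of_append).append
        hB.right_of_append ?_) ?_
      · have : (l₁ ++ [x]).head? = some v := by
          have := congrArg List.head? hl'
          rw [List.head?_append_of_ne_nil _ (by simp)] at this
          exact this.symm
        rw [List.getLast?_reverse, this]
        simpa using hy
      · simpa using hx
  have hAc : (A ++ [u]).IsChain fun x y => ¬(G.Adj u x ∧ G.Adj v y) := by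
    rw [List.isChain_iff_forall_rel_of_append_cons_cons]
    rintro x y l₁ l₂ hl ⟨hx, hy⟩
    have hl' : A ++ [u] = (l₁ ++ [x]) ++ (y :: l₂) := by simp [hl]
    rw [hl'] at hA
    have hlast : (y :: l₂).getLast? = some u := by
      have := congrArg List.getLast? hl'
      rw [List.getLast?_append_of_ne_nil _ (by simp : y :: l₂ ≠ [])] at this
      simpa using this.symm
    refine hno (((l₁ ++ [x]) ++ (y :: l₂).reverse) ++ (v :: B)) ?_ ?_
    · have : A ++ u :: v :: B = ((l₁ ++ [x]) ++ (y :: l₂)) ++ (v :: B) := by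
        rw [← hl']; simp
      rw [this]
      exact List.Perm.append_right _ (List.Perm.append_left _ (List.reverse_perm _))
    · refine List.IsChain.append (hA.left_of_append.append
        (SimpleGraph.isChain_adj_reverse.2 hA.right_of_append) ?_) hB ?_
      · rw [List.head?_reverse, hlast]
        simpa using hx.symm
      · rw [List.getLast?_append_of_ne_nil _ (by simp), List.getLast?_reverse]
        simpa using hy.symm
  have hcA : (A ++ [u]).countP (fun x => G.Adj u x) + (A ++ [u]).countP (fun x => G.Adj v x)
      ≤ A.length := by
    have hl : ∀ x ∈ (A ++ [u]).getLast?, ¬ G.Adj u x := by simp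
    have hlen : (A ++ [u]).length = A.length + 1 := by simp
    generalize A ++ [u] = L at *
    cases L with
    | nil => simp at hlen
    | cons a l =>
      have := List.countP_add_countP_tail_le (G.Adj u) (G.Adj v) a l hAc hl
      rw [List.countP_cons (p := fun x => decide (G.Adj v x)),
        if_neg (by simpa using hAh a (by simp))]
      simp only [List.length_cons] at hlen
      omega
  have hcB : (v :: B).countP (fun x => G.Adj u x) + (v :: B).countP (fun x => G.Adj v x)
      ≤ B.length := by
    have := List.countP_add_countP_tail_le (G.Adj u) (G.Adj v) v B hBc hBl
    rw [List.countP_cons (p := fun x => decide (G.Adj v x)), if_neg (by simp)]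
    omega
  have hsplit : A ++ u :: v :: B = (A ++ [u]) ++ (v :: B) := by simp
  rw [G.degree_eq_countP hnd hmem u, G.degree_eq_countP hnd hmem v, hcard, hsplit,
    List.countP_append (l₁ := A ++ [u]), List.countP_append (l₁ := A ++ [u])]
  omega

open Classical in
/-- Ore's closure lemma for Hamiltonian paths. -/
theorem degree_add_degree_of_sup_edge {V : Type*} [Fintype V] {G : SimpleGraph V}
    (hG : ¬ ∃ l, IsHamiltonianList G l) {u v : V}
    (huv : ∃ l, IsHamiltonianList (G ⊔ SimpleGraph.edge u v) l) :
    G.degree u + G.degree v + 2 ≤ Fintype.card V := by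
  obtain ⟨l, hnd, hmem, hc⟩ := huv
  -- The path must use the added edge; removing it there leaves two paths of `G`.
  have hnc : ¬ l.IsChain G.Adj := fun h => hG ⟨l, hnd, hmem, h⟩
  rw [List.isChain_iff_forall_rel_of_append_cons_cons] at hnc
  push Not at hnc
  obtain ⟨a, b, A, B, rfl, hab⟩ := hnc
  have hab' : (G ⊔ SimpleGraph.edge u v).Adj a b :=
    List.isChain_iff_forall_rel_of_append_cons_cons.1 hc rfl
  have huv : (a = u ∧ b = v) ∨ (a = v ∧ b = u) := by
    rw [SimpleGraph.sup_adj, SimpleGraph.edge_adj] at hab'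
    rcases hab' with h | h
    · exact absurd h hab
    · tauto
  have hG' : ∀ x y, (G ⊔ SimpleGraph.edge u v).Adj x y → (x ≠ a ∧ y ≠ a) ∨ (x ≠ b ∧ y ≠ b) →
      G.Adj x y := by
    intro x y hxy hne
    rw [SimpleGraph.sup_adj, SimpleGraph.edge_adj] at hxy
    rcases hxy with h | h
    · exact h
    · rcases huv with ⟨rfl, rfl⟩ | ⟨rfl, rfl⟩ <;> tauto
  have hsplit : A ++ a :: b :: B = (A ++ [a]) ++ (b :: B) := by simp
  have hdisj : List.Disjoint (A ++ [a]) (b :: B) := by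
    rw [hsplit] at hnd
    exact List.disjoint_of_nodup_append hnd
  rw [hsplit] at hc
  have key := degree_add_degree_of_two_paths hG hnd hmem
    (hc.left_of_append.imp_of_mem_imp fun x y hx hy h => hG' x y h (Or.inr
      ⟨fun e => hdisj hx (e ▸ List.mem_cons_self), fun e => hdisj hy (e ▸ List.mem_cons_self)⟩))
    (hc.right_of_append.imp_of_mem_imp fun x y hx hy h => hG' x y h (Or.inl
      ⟨fun e => hdisj (by simp : a ∈ A ++ [a]) (e ▸ hx),
        fun e => hdisj (by simp : a ∈ A ++ [a]) (e ▸ hy)⟩))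
  rcases huv with ⟨rfl, rfl⟩ | ⟨rfl, rfl⟩ <;> omega

open Classical in
-- Edges between `T` and its complement are counted by the degrees in `T`, so they add at most
-- another `#T * h`; the rest lies inside the complement.
theorem sum_degree_le_of_low_degree_set {V : Type*} [Fintype V] (G : SimpleGraph V)
    (T : Finset V) (h : ℕ) (hT : ∀ v ∈ T, G.degree v ≤ h) :
    ∑ v, G.degree v ≤ 2 * (#T * h) + #Tᶜ * (#Tᶜ - 1) := by
  have h1 : ∑ v ∈ T, G.degree v ≤ #T * h := by
    rw [← smul_eq_mul]; exact Finset.sum_le_card_nsmul _ _ _ hT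
  have h2 : ∀ v ∈ Tᶜ, G.degree v ≤ #{u ∈ T | G.Adj u v} + (#Tᶜ - 1) := by
    intro v hv
    have hsub : G.neighborFinset v ⊆ {u ∈ T | G.Adj u v} ∪ Tᶜ.erase v := by
      intro u hu
      rw [SimpleGraph.mem_neighborFinset] at hu
      simp only [Finset.mem_union, Finset.mem_filter, Finset.mem_erase, Finset.mem_compl]
      by_cases huT : u ∈ T
      · exact Or.inl ⟨huT, hu.symm⟩
      · exact Or.inr ⟨hu.ne', huT⟩
    rw [← G.card_neighborFinset_eq_degree, ← Finset.card_erase_of_mem hv]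
    exact (Finset.card_le_card hsub).trans (Finset.card_union_le _ _)
  have h3 : ∑ v ∈ Tᶜ, #{u ∈ T | G.Adj u v} ≤ ∑ u ∈ T, G.degree u := by
    have := Finset.sum_card_bipartiteAbove_eq_sum_card_bipartiteBelow (s := T) (t := Tᶜ) G.Adj
    simp only [Finset.bipartiteAbove, Finset.bipartiteBelow] at this
    rw [← this]
    refine Finset.sum_le_sum fun u _ => ?_
    rw [← G.card_neighborFinset_eq_degree]
    exact Finset.card_le_card fun x hx => by simpa using (Finset.mem_filter.1 hx).2
  have h4 := Finset.sum_le_sum h2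
  rw [Finset.sum_add_distrib, Finset.sum_const, smul_eq_mul] at h4
  rw [← Finset.sum_add_sum_compl T]
  omega

open Classical in
theorem exists_isHamiltonianList_of_lt_sum_degree {V : Type*} [Fintype V] {n : ℕ}
    (G : SimpleGraph V) (hcard : Fintype.card V = n) (hn : 10 ≤ n) (hdeg : ∀ v, 0 < G.degree v)
    (hsum : n ^ 2 + 10 < ∑ v, G.degree v + 5 * n) : ∃ l, IsHamiltonianList G l := by
  by_contra hG
  -- In an edge-maximal counterexample `H`, adding any missing edge creates a Hamiltonian path, so
  -- Ore's lemma bounds every nonadjacent pair.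
  obtain ⟨H, hGH, hH⟩ := (Set.toFinite
    {H : SimpleGraph V | ¬ ∃ l, IsHamiltonianList H l}).exists_le_maximal hG
  have hle : ∀ v, G.degree v ≤ H.degree v := fun v => SimpleGraph.degree_le_of_le hGH
  have hdegH : ∀ v, 0 < H.degree v := fun v => (hdeg v).trans_le (hle v)
  have hsumH : n ^ 2 + 10 < ∑ v, H.degree v + 5 * n :=
    hsum.trans_le (Nat.add_le_add_right (Finset.sum_le_sum fun v _ => hle v) _)
  have hnH : ¬ ∃ l, IsHamiltonianList H l := hH.prop
  have hore : ∀ u v, u ≠ v → ¬ H.Adj u v → H.degree u + H.degree v + 2 ≤ n := by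
    intro u v huv hadj
    rw [← hcard]
    refine degree_add_degree_of_sup_edge hnH (by_contra fun hno => hadj ?_)
    refine hH.le_of_ge hno le_sup_left ?_
    simp [SimpleGraph.edge_adj, huv]
  let P : Finset (V × V) := {p | p.1 ≠ p.2 ∧ ¬ H.Adj p.1 p.2}
  have hP : P.Nonempty := by
    by_contra hP
    rw [Finset.not_nonempty_iff_eq_empty] at hP
    refine hnH ⟨Finset.univ.toList, Finset.nodup_toList _, by simp, ?_⟩
    refine List.Pairwise.isChain ((Finset.nodup_toList _).imp fun {a b} hab => ?_)
    by_contra hadj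
    have : (a, b) ∈ P := by simp [P, hab, hadj]
    simp [hP] at this
  obtain ⟨u, v, huv, hadj, hmax, hle⟩ : ∃ u v, u ≠ v ∧ ¬ H.Adj u v ∧
      (∀ a b, a ≠ b → ¬ H.Adj a b → H.degree a + H.degree b ≤ H.degree u + H.degree v) ∧
      H.degree u ≤ H.degree v := by
    obtain ⟨⟨u, v⟩, hp, hmax⟩ := P.exists_max_image (fun p => H.degree p.1 + H.degree p.2) hP
    have hmax' : ∀ a b, a ≠ b → ¬ H.Adj a b →
        H.degree a + H.degree b ≤ H.degree u + H.degree v :=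
      fun a b hab hn => hmax (a, b) (by simp [P, hab, hn])
    simp only [P, Finset.mem_filter, Finset.mem_univ, true_and] at hp
    rcases le_total (H.degree u) (H.degree v) with h | h
    · exact ⟨u, v, hp.1, hp.2, hmax', h⟩
    · refine ⟨v, u, hp.1.symm, fun h => hp.2 h.symm, fun a b h1 h2 => ?_, h⟩
      have := hmax' a b h1 h2
      omega
  have huv2 := hore u v huv hadj
  -- By maximality of `d(u) + d(v)`, every non-neighbour of `v` has degree at most `d(u)`; there are
  -- `n - 1 - d(v) ≥ d(u) + 1` of them.
  let N : Finset V := (insert v (H.neighborFinset v))ᶜ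
  have hN : H.degree u + 1 ≤ #N := by
    have h1 := Finset.card_compl_add_card (insert v (H.neighborFinset v))
    rw [Finset.card_insert_of_notMem (by simp), H.card_neighborFinset_eq_degree, hcard] at h1
    simp only [N]
    omega
  obtain ⟨T, hTN, hTc⟩ := Finset.exists_subset_card_eq hN
  have hT : ∀ x ∈ T, H.degree x ≤ H.degree u := by
    intro x hx
    have := hTN hx
    simp only [N, Finset.mem_compl, Finset.mem_insert, SimpleGraph.mem_neighborFinset,
      not_or] at this
    have := hmax x v this.1 (fun h => this.2 h.symm)
    omega
  have hfin := sum_degree_le_of_low_degree_set H T _ hT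
  have hTcc := Finset.card_compl_add_card T
  rw [hTc] at hfin hTcc
  rw [hcard] at hTcc
  have hu := hdegH u
  generalize H.degree u = h at *
  -- With `h = d(u)`, the bound `2h(h+1) + (n-h-1)(n-h-2)` is at most its value `n² - 5n + 10` at `h
  -- = 1`, since `1 ≤ h ≤ (n-2)/2` and `n ≥ 10`.
  obtain ⟨m, hm⟩ : ∃ m, #Tᶜ = m + 1 := ⟨#Tᶜ - 1, by omega⟩
  rw [hm] at hfin hTcc
  obtain rfl : n = m + h + 2 := by omega
  obtain ⟨k, rfl⟩ : ∃ k, h = k + 1 := ⟨h - 1, by omega⟩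
  obtain ⟨j, rfl⟩ : ∃ j, m = k + 1 + j := ⟨m - (k + 1), by omega⟩
  simp only [Nat.add_sub_cancel] at hfin
  have h6 : 6 ≤ k + 2 * j + k := by omega
  nlinarith [Nat.mul_le_mul_left k h6]

/-! ### Bounds on the largest eigenvalue. -/

open Classical in
theorem aAlphaMatrix_mulVec_apply {V : Type*} [Fintype V] (α : ℝ) (G : SimpleGraph V)
    (x : V → ℝ) (v : V) :
    (aAlphaMatrix α G).mulVec x v
      = α * (G.degree v * x v) + (1 - α) * ∑ u ∈ G.neighborFinset v, x u := by
  simp [aAlphaMatrix, Matrix.add_mulVec, Matrix.smul_mulVec, SimpleGraph.degMatrix,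
    Matrix.mulVec_diagonal, SimpleGraph.adjMatrix_mulVec_apply]

open Classical in
/-- The Rayleigh principle for `A_α(G)`. -/
theorem dotProduct_aAlphaMatrix_le {V : Type*} [Fintype V] [Nonempty V] (α : ℝ)
    (G : SimpleGraph V) (x : V → ℝ) :
    x ⬝ᵥ (aAlphaMatrix α G).mulVec x ≤ lambdaAlpha α G * (x ⬝ᵥ x) := by
  have hA := aAlphaMatrix_isHermitian α G
  have hB : (lambdaAlpha α G • (1 : Matrix V V ℝ) - aAlphaMatrix α G).IsHermitian := by
    refine Matrix.IsHermitian.sub ?_ hA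
    simp [Matrix.IsHermitian]
  have hpos : (lambdaAlpha α G • (1 : Matrix V V ℝ) - aAlphaMatrix α G).PosSemidef := by
    rw [hB.posSemidef_iff_eigenvalues_nonneg]
    intro i
    have hi := hB.eigenvalues_mem_spectrum_real i
    generalize hB.eigenvalues i = c at hi ⊢
    rw [← Algebra.algebraMap_eq_smul_one, ← spectrum.singleton_sub_eq] at hi
    obtain ⟨a, ha, b, hb, hab⟩ := Set.mem_sub.1 hi
    rw [Set.mem_singleton_iff] at ha
    have hfin : (spectrum ℝ (aAlphaMatrix α G)).Finite := Matrix.finite_real_spectrum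
    have : b ≤ lambdaAlpha α G := le_csSup hfin.bddAbove hb
    simp only [Pi.zero_apply]
    linarith
  have := hpos.dotProduct_mulVec_nonneg x
  simp only [star_trivial, Matrix.sub_mulVec, Matrix.smul_mulVec, Matrix.one_mulVec,
    dotProduct_sub, dotProduct_smul, smul_eq_mul] at this
  linarith

open Classical in
-- Rayleigh quotient of the indicator vector of the clique.
theorem card_sub_one_le_lambdaAlpha {V : Type*} [Fintype V] {α : ℝ} (hα₀ : 0 ≤ α)
    (hα₁ : α ≤ 1) (G : SimpleGraph V) (S : Finset V) (hS : S.Nonempty)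
    (hclique : G.IsClique S) : (#S : ℝ) - 1 ≤ lambdaAlpha α G := by
  have : Nonempty V := ⟨hS.choose⟩
  let x : V → ℝ := fun v => if v ∈ S then 1 else 0
  have hx := dotProduct_aAlphaMatrix_le α G x
  have hxx : x ⬝ᵥ x = #S := by simp [dotProduct, x]
  have hxA : (#S : ℝ) * (#S - 1) ≤ x ⬝ᵥ (aAlphaMatrix α G).mulVec x := by
    have : x ⬝ᵥ (aAlphaMatrix α G).mulVec x = ∑ v ∈ S, (aAlphaMatrix α G).mulVec x v := by
      simp [dotProduct, x]
    rw [this, ← nsmul_eq_mul]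
    refine Finset.card_nsmul_le_sum _ _ _ fun v hv => ?_
    have hsub : S.erase v ⊆ G.neighborFinset v := fun u hu => by
      rw [Finset.mem_erase] at hu
      simpa using hclique hv hu.2 hu.1.symm
    have hcard : (#(S.erase v) : ℝ) = #S - 1 := by
      rw [Finset.card_erase_of_mem hv, Nat.cast_sub (Finset.card_pos.2 hS), Nat.cast_one]
    have hdeg : (#S : ℝ) - 1 ≤ G.degree v := by
      rw [← hcard, ← G.card_neighborFinset_eq_degree]
      exact_mod_cast Finset.card_le_card hsub
    have hsum : (#S : ℝ) - 1 ≤ ∑ u ∈ G.neighborFinset v, x u := by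
      rw [← hcard]
      calc (#(S.erase v) : ℝ) = ∑ u ∈ S.erase v, x u := by
            rw [Finset.sum_congr rfl fun u hu => if_pos (Finset.mem_of_mem_erase hu)]
            simp
        _ ≤ _ := Finset.sum_le_sum_of_subset_of_nonneg hsub fun u _ _ => by
            simp only [x]; split_ifs <;> norm_num
    rw [aAlphaMatrix_mulVec_apply]
    have : x v = 1 := if_pos hv
    rw [this]
    nlinarith
  have hpos : (0 : ℝ) < #S := by exact_mod_cast Finset.card_pos.2 hS
  rw [hxx] at hx
  nlinarith

theorem sub_two_le_lambdaAlpha_extremalGraph {α : ℝ} (hα₀ : 0 ≤ α) (hα₁ : α ≤ 1) {n : ℕ}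
    (hn : 2 ≤ n) : (n : ℝ) - 2 ≤ lambdaAlpha α (extremalGraph n) := by
  let S : Finset (Fin 1 ⊕ (Fin (n - 2) ⊕ Fin 1)) :=
    Finset.univ.disjSum (Finset.univ.disjSum ∅)
  have hcard : #S = n - 1 := by
    simp [S, Finset.card_disjSum]; omega
  have h := card_sub_one_le_lambdaAlpha hα₀ hα₁ (extremalGraph n) S ⟨Sum.inl 0, by simp [S]⟩ ?_
  · rw [hcard, Nat.cast_sub (by omega)] at h
    push_cast at h
    linarith
  · rintro (a | a | a) ha (b | b | b) hb hab <;>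
      simp_all [S, extremalGraph, graphJoin, Fin.eq_zero]

open Classical in
/-- A nonzero nonnegative vector with `λ_α(G) y ≤ A_α(G) y`. -/
theorem exists_nonneg_le_aAlphaMatrix_mulVec {V : Type*} [Fintype V] [Nonempty V] {α : ℝ}
    (hα₀ : 0 ≤ α) (hα₁ : α ≤ 1) (G : SimpleGraph V) :
    ∃ y : V → ℝ, (∀ v, 0 ≤ y v) ∧ (∃ v, 0 < y v) ∧ ∀ v,
      lambdaAlpha α G * y v ≤
        α * (G.degree v * y v) + (1 - α) * ∑ u ∈ G.neighborFinset v, y u := by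
  -- Absolute values of an eigenvector suffice: the entries of the matrix are nonnegative, so the
  -- triangle inequality applies row by row.
  obtain ⟨x, hx⟩ := (isGreatest_lambdaAlpha α G).1.exists_hasEigenvector
  refine ⟨fun v => |x v|, fun v => abs_nonneg _, ?_, fun v => ?_⟩
  · obtain ⟨v, hv⟩ := Function.ne_iff.1 hx.2
    exact ⟨v, abs_pos.2 hv⟩
  · have h := congrFun hx.apply_eq_smul v
    rw [Matrix.toLin'_apply, aAlphaMatrix_mulVec_apply, Pi.smul_apply, smul_eq_mul] at h
    calc lambdaAlpha α G * |x v| ≤ |lambdaAlpha α G * x v| := by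
          rw [abs_mul]; gcongr; exact le_abs_self _
      _ ≤ _ := by
          rw [← h]
          refine (abs_add_le _ _).trans ?_
          rw [abs_mul, abs_mul, abs_mul, abs_of_nonneg hα₀, abs_of_nonneg (sub_nonneg.2 hα₁),
            Nat.abs_cast]
          have := sub_nonneg.2 hα₁
          gcongr
          · exact Finset.abs_sum_le_sum_abs _ _

open Classical in
-- The eigenvalue inequality is used twice at a maximal coordinate `y v`: once at `v`, and once at
-- each neighbour `u` as `λ y u ≤ d(u) y v`.
theorem exists_lambdaAlpha_mul_le {V : Type*} [Fintype V] [Nonempty V] {α : ℝ}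
    (hα₀ : 0 ≤ α) (hα₁ : α ≤ 1) (G : SimpleGraph V) (hpos : 0 ≤ lambdaAlpha α G) :
    ∃ v, lambdaAlpha α G * (lambdaAlpha α G - α * G.degree v) ≤
      (1 - α) * ∑ u ∈ G.neighborFinset v, (G.degree u : ℝ) := by
  obtain ⟨y, hy₀, ⟨w, hw⟩, hy⟩ := exists_nonneg_le_aAlphaMatrix_mulVec hα₀ hα₁ G
  obtain ⟨v, hv⟩ := Finite.exists_max y
  refine ⟨v, ?_⟩
  have hyv : 0 < y v := hw.trans_le (hv w)
  have h1 : ∀ u, lambdaAlpha α G * y u ≤ G.degree u * y v := fun u => by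
    have h2 : ∑ t ∈ G.neighborFinset u, y t ≤ G.degree u * y v := by
      rw [← G.card_neighborFinset_eq_degree, ← nsmul_eq_mul]
      exact Finset.sum_le_card_nsmul _ _ _ fun t _ => hv t
    calc _ ≤ _ := hy u
      _ ≤ α * (G.degree u * y v) + (1 - α) * (G.degree u * y v) := by
          have := sub_nonneg.2 hα₁
          gcongr
          · exact hv u
      _ = _ := by ring
  refine le_of_mul_le_mul_right ?_ hyv
  calc lambdaAlpha α G * (lambdaAlpha α G - α * G.degree v) * y v
      = lambdaAlpha α G * (lambdaAlpha α G * y v - α * (G.degree v * y v)) := by ring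
    _ ≤ lambdaAlpha α G * ((1 - α) * ∑ u ∈ G.neighborFinset v, y u) := by
        gcongr; linarith [hy v]
    _ = (1 - α) * ∑ u ∈ G.neighborFinset v, lambdaAlpha α G * y u := by
        rw [Finset.mul_sum, Finset.mul_sum, Finset.mul_sum]
        exact Finset.sum_congr rfl fun u _ => by ring
    _ ≤ (1 - α) * ∑ u ∈ G.neighborFinset v, G.degree u * y v := by
        exact mul_le_mul_of_nonneg_left (Finset.sum_le_sum fun u _ => h1 u) (sub_nonneg.2 hα₁)
    _ = _ := by rw [← Finset.sum_mul]; ring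

open Classical in
-- Row sums after rescaling by degrees: `v` maximises `y v / d(v)`.
theorem exists_lambdaAlpha_mul_degree_le {V : Type*} [Fintype V] [Nonempty V] {α : ℝ}
    (hα₀ : 0 ≤ α) (hα₁ : α ≤ 1) (G : SimpleGraph V) (hdeg : ∀ v, 0 < G.degree v) :
    ∃ v, lambdaAlpha α G * G.degree v ≤
      α * (G.degree v : ℝ) ^ 2 + (1 - α) * ∑ u ∈ G.neighborFinset v, (G.degree u : ℝ) := by
  obtain ⟨y, hy₀, ⟨w, hw⟩, hy⟩ := exists_nonneg_le_aAlphaMatrix_mulVec hα₀ hα₁ G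
  have hd : ∀ v, (0 : ℝ) < G.degree v := fun v => by exact_mod_cast hdeg v
  obtain ⟨v, hv⟩ := Finite.exists_max fun v => y v / G.degree v
  refine ⟨v, ?_⟩
  set r := y v / G.degree v with hr
  have hr₀ : 0 < r := (div_pos hw (hd w)).trans_le (hv w)
  have hyv : y v = G.degree v * r := by rw [hr]; field_simp [(hd v).ne']
  have hyu : ∀ u, y u ≤ G.degree u * r := fun u => by
    have := (div_le_iff₀ (hd u)).1 (hv u)
    linarith
  refine le_of_mul_le_mul_right ?_ hr₀
  calc lambdaAlpha α G * G.degree v * r = lambdaAlpha α G * y v := by rw [hyv]; ring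
    _ ≤ _ := hy v
    _ ≤ α * (G.degree v * y v) + (1 - α) * ∑ u ∈ G.neighborFinset v, G.degree u * r := by
        have := sub_nonneg.2 hα₁
        gcongr with u
        exact hyu u
    _ = _ := by rw [hyv, ← Finset.sum_mul]; ring

/-! ### From the eigenvalue to the degree sum. -/

open Classical in
-- Each vertex outside the closed neighbourhood of `v` takes at least 1 from the total, and `v`
-- takes `d(v)`.
theorem sum_neighborFinset_degree_le {V : Type*} [Fintype V] (G : SimpleGraph V)
    (hdeg : ∀ v, 0 < G.degree v) (v : V) :
    ∑ u ∈ G.neighborFinset v, (G.degree u : ℝ) ≤ ∑ u, (G.degree u : ℝ) - Fintype.card V + 1 := by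
  have hd : ∀ v, (1 : ℝ) ≤ G.degree v := fun v => by exact_mod_cast hdeg v
  have hv : v ∉ G.neighborFinset v := by simp
  have h1 : ∑ u ∈ G.neighborFinset v, ((G.degree u : ℝ) - 1) + ((G.degree v : ℝ) - 1)
      ≤ ∑ u, ((G.degree u : ℝ) - 1) := by
    rw [add_comm, ← Finset.sum_insert (f := fun u => (G.degree u : ℝ) - 1) hv]
    exact Finset.sum_le_sum_of_subset_of_nonneg (Finset.subset_univ _)
      fun u _ _ => by linarith [hd u]
  simp only [Finset.sum_sub_distrib, Finset.sum_const, nsmul_eq_mul, mul_one,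
    Finset.card_univ, SimpleGraph.card_neighborFinset_eq_degree] at h1
  linarith

open Classical in
theorem lt_sum_degree_of_le_lambdaAlpha {V : Type*} [Fintype V] {α : ℝ} (hα₀ : 0 ≤ α)
    (hα₁ : α < 2 / 3) (G : SimpleGraph V) {n : ℕ} (hcard : Fintype.card V = n) (hn : 8 ≤ n)
    (hdeg : ∀ v, 0 < G.degree v) (hspec : (n : ℝ) - 2 ≤ lambdaAlpha α G) :
    (n : ℝ) ^ 2 - 5 * n + 10 < ∑ v, (G.degree v : ℝ) := by
  have : Nonempty V := Fintype.card_pos_iff.1 (by omega)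
  by_contra! hsum
  have hn' : (8 : ℝ) ≤ n := by exact_mod_cast hn
  have hmax : ∀ v, (G.degree v : ℝ) ≤ n - 1 := fun v => by
    have := G.degree_lt_card_verts v
    rw [hcard] at this
    have : ((G.degree v + 1 : ℕ) : ℝ) ≤ n := by exact_mod_cast this
    push_cast at this
    linarith
  have hS : ∀ v, ∑ u ∈ G.neighborFinset v, (G.degree u : ℝ) ≤ (n : ℝ) ^ 2 - 6 * n + 11 :=
    fun v => (sum_neighborFinset_degree_le G hdeg v).trans (by rw [hcard]; linarith)
  -- The unweighted estimate contradicts the assumed degree sum for `α ≤ 1/2` but not up to `2/3`;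
  -- beyond `1/2` the degree-weighted one takes over.
  rcases le_total α (1 / 2) with hα | hα
  · obtain ⟨v, hv⟩ := exists_lambdaAlpha_mul_le hα₀ (by linarith) G (by linarith)
    have h1 : ((n : ℝ) - 2) * (n - 2 - α * (n - 1))
        ≤ lambdaAlpha α G * (lambdaAlpha α G - α * G.degree v) := by
      have := mul_le_mul_of_nonneg_left (hmax v) hα₀
      have : 0 ≤ (n : ℝ) - 2 - α * (n - 1) := by nlinarith
      exact mul_le_mul hspec (by linarith) this (by linarith)
    have h2 := mul_le_mul_of_nonneg_left (hS v) (by linarith : 0 ≤ 1 - α)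
    nlinarith
  · obtain ⟨v, hv⟩ := exists_lambdaAlpha_mul_degree_le hα₀ (by linarith) G hdeg
    have hd : (1 : ℝ) ≤ G.degree v := by exact_mod_cast hdeg v
    have h0 := mul_le_mul_of_nonneg_right hspec (by linarith : 0 ≤ (G.degree v : ℝ))
    have h1 : ∑ u ∈ G.neighborFinset v, (G.degree u : ℝ) ≤ G.degree v * (n - 1) := by
      rw [← G.card_neighborFinset_eq_degree v, ← nsmul_eq_mul]
      exact Finset.sum_le_card_nsmul _ _ _ fun t _ => hmax t
    have h2 := mul_le_mul_of_nonneg_left (hS v) (by linarith : 0 ≤ 1 - α)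
    have h3 := mul_le_mul_of_nonneg_left h1 (by linarith : 0 ≤ 1 - α)
    have hm := hmax v
    generalize (G.degree v : ℝ) = d at *
    -- For `d ≤ n - 4` the trivial bound `d(n - 1)` on the neighbour sum gives `n - 2 ≤ n - 1 - 3α`,
    -- which is false. For larger `d` the edge bound is used, with `d²` replaced by its secant on
    -- `[n - 4, n - 1]`.
    rcases le_total d (n - 4) with hd4 | hd4
    · have : 0 ≤ d * (α * (n - 4 - d)) := by
        apply mul_nonneg (by linarith) (mul_nonneg hα₀ (by linarith))
      have : 0 < d * (3 * α - 1) := mul_pos (by linarith) (by linarith)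
      nlinarith
    · have : 0 ≤ α * ((d - (n - 4)) * (n - 1 - d)) :=
        mul_nonneg hα₀ (mul_nonneg (by linarith) (by linarith))
      have h4 : (n - 2) * d ≤ α * d ^ 2 + (1 - α) * ((n : ℝ) ^ 2 - 6 * n + 11) := by linarith
      have h5 : (n - 2) * d ≤ α * ((2 * n - 5) * d - (n - 4) * (n - 1))
          + (1 - α) * ((n : ℝ) ^ 2 - 6 * n + 11) := by nlinarith
      -- affine in `d`: compare at the endpoints `n - 4` and `n - 1`
      have h6 : 0 < (1 - α) * (4 * n - 10) - (n - 1) := by nlinarith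
      have h7 : 0 < 2 * (n : ℝ) - 8 - (1 - α) * (2 * n - 5) := by nlinarith
      have h8 := mul_nonneg (sub_nonneg.2 hd4) h6.le
      have h9 := mul_nonneg (sub_nonneg.2 hm) h7.le
      rcases hm.lt_or_eq with hm' | hm'
      · have h10 := mul_pos (sub_pos.2 hm') h7
        nlinarith
      · subst hm'
        nlinarith

theorem theorem1p1 {V : Type*} [Fintype V] (α : ℝ) (hα₀ : 0 ≤ α) (hα₁ : α < 2 / 3)
    (n : ℕ) (hn : 25 ≤ n) (G : SimpleGraph V) (hcard : Fintype.card V = n)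
    (hG : G.Connected) (hspec : lambdaAlpha α (extremalGraph n) ≤ lambdaAlpha α G) :
    HasPathFactor {3, 4, 5} G ∨ Nonempty (G ≃g extremalGraph n) := by
  classical
  have : Nontrivial V := Fintype.one_lt_card_iff_nontrivial.1 (by omega)
  have hdeg : ∀ v, 0 < G.degree v := fun v => hG.preconnected.degree_pos_of_nontrivial v
  have hlow : (n : ℝ) - 2 ≤ lambdaAlpha α G :=
    (sub_two_le_lambdaAlpha_extremalGraph hα₀ (by linarith) (by omega)).trans hspec
  have hsum := lt_sum_degree_of_le_lambdaAlpha hα₀ hα₁ G hcard (by omega)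
    (fun v => by convert hdeg v) hlow
  have hsum' : n ^ 2 + 10 < ∑ v, G.degree v + 5 * n := by
    have : (n : ℝ) ^ 2 + 10 < ∑ v, (G.degree v : ℝ) + 5 * n := by
      convert (by linarith : (n : ℝ) ^ 2 + 10 < _ + 5 * n)
    exact_mod_cast this
  obtain ⟨l, hl⟩ := exists_isHamiltonianList_of_lt_sum_degree G hcard (by omega)
    (fun v => by convert hdeg v) (by convert hsum')
  refine Or.inl (hl.hasPathFactor ?_)
  have huniv : l.toFinset = Finset.univ := by
    ext x; simpa using hl.2.1 x
  rw [← List.toFinset_card_of_nodup hl.1, huniv, Finset.card_univ, hcard]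
  omega
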